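/- Let $c>0$ and $\lambda>0$, and let $m\in\{0,1\}$. Let $(N(t))_{t\ge 0}$ be a homogeneous Poisson process with rate $\lambda$, let $s_0=0$ and let $s_j$ be the time of its $j$-th event. Let $\theta_1,\theta_2,\dots$ be independent random variables, independent of the Poisson process, each with density $$f_m(\theta)=\frac{\Gamma(m+1)}{\sqrt{\pi}\,\Gamma(m+\frac12)}\sin^{2m}\theta,\qquad \theta\in(0,\pi).$$ For $t>0$ put $$X_m(t)=c\sum_{j=1}^{N(t)+1}(s_j-s_{j-1})\cos\theta_j,$$ where in this sum $s_{N(t)+1}$ is replaced by $t$. For $n\ge 1$ set $v_0=\frac n2$ and $v_1=n+1$. Then for every $t>0$, every integer $n\ge 1$ and all real $\alpha\ne 0$ and $\beta\neq 0$, $$E\left\{e^{i\alpha X_m(t)}\,\middle|\,N(t)=n\right\}=\frac{\Gamma(v_m+1)\,2^{v_m}}{(\alpha ct)^{v_m}}\,J_{v_m}(\alpha ct),\qquad E\left\{e^{\beta X_m(t)}\,\middle|\,N(t)=n\right\}=\frac{\Gamma(v_m+1)\,2^{v_m}}{(\beta ct)^{v_m}}\,I_{v_m}(\beta ct),$$ where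 $$J_v(x)=\sum_{k=0}^\infty(-1)^k\frac{(x/2)^{2k+v}}{\Gamma(k+1)\Gamma(k+v+1)},\qquad I_v(x)=\sum_{k=0}^\infty\frac{(x/2)^{2k+v}}{\Gamma(k+1)\Gamma(k+v+1)}$$ are the Bessel and modified Bessel functions, and for negative arguments all powers are taken on the principal branch. -/

import Mathlib

open MeasureTheory ProbabilityTheory

/-- Bessel function of the first kind of real order `ν` (principal branch of the power):
`J_ν(z) = ∑ (-1)^k (z/2)^(2k+ν) / (Γ(k+1) Γ(k+ν+1))`. -/
noncomputable def besselJ (ν : ℝ) (z : ℂ) : ℂ :=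
  ∑' k : ℕ, (-1 : ℂ) ^ k * (z / 2) ^ (2 * (k : ℂ) + (ν : ℂ)) /
    (Complex.Gamma ((k : ℂ) + 1) * Complex.Gamma ((k : ℂ) + (ν : ℂ) + 1))

/-- Modified Bessel function of the first kind of real order `ν` (principal branch of the power):
`I_ν(z) = ∑ (z/2)^(2k+ν) / (Γ(k+1) Γ(k+ν+1))`. -/
noncomputable def besselI (ν : ℝ) (z : ℂ) : ℂ :=
  ∑' k : ℕ, (z / 2) ^ (2 * (k : ℂ) + (ν : ℂ)) /
    (Complex.Gamma ((k : ℂ) + 1) * Complex.Gamma ((k : ℂ) + (ν : ℂ) + 1))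

/-- `N` is a homogeneous Poisson process with rate `rate`, and `s j` is the time at which its
`j`-th event occurs (with `s 0 = 0`): `N` counts the events, that is, almost surely `j ≤ N t`
exactly when `s j ≤ t`, and the waiting times between consecutive events are independent and
exponentially distributed with parameter `rate`. -/
structure IsPoissonProcess {Ω : Type*} [MeasurableSpace Ω] (N : ℝ → Ω → ℕ) (s : ℕ → Ω → ℝ)
    (rate : ℝ) (μ : Measure Ω) : Prop where
  measurable_count : ∀ t, Measurable (N t)
  measurable_time : ∀ j, Measurable (s j)
  time_zero : ∀ ω, s 0 ω = 0
  le_count_iff : ∀ᵐ ω ∂μ, ∀ t : ℝ, 0 ≤ t → ∀ j : ℕ, j ≤ N t ω ↔ s j ω ≤ t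
  iIndepFun_wait : iIndepFun (fun (j : ℕ) (ω : Ω) => s (j + 1) ω - s j ω) μ
  hasLaw_wait : ∀ j : ℕ, HasLaw (fun ω => s (j + 1) ω - s j ω) (expMeasure rate) μ

/-- The law on `(0, π)` with density
`f_ν(θ) = Γ(ν+1) / (√π Γ(ν+1/2)) * sin(θ)^(2ν)`. -/
noncomputable def angleLaw (ν : ℝ) : Measure ℝ :=
  (volume.restrict (Set.Ioo 0 Real.pi)).withDensity fun x =>
    ENNReal.ofReal (Real.Gamma (ν + 1) / (Real.sqrt Real.pi * Real.Gamma (ν + 1 / 2)) *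
      Real.sin x ^ (2 * ν))

/-- The times `0 = s_0, s_1, …, s_{N(t)}, s_{N(t)+1} = t` that cut `[0, t]` into the intervals of
constant velocity. -/
def switchTime {Ω : Type*} (N : ℝ → Ω → ℕ) (s : ℕ → Ω → ℝ) (t : ℝ) (j : ℕ) (ω : Ω) : ℝ :=
  if j ≤ N t ω then s j ω else t

/-- The position at time `t`, `X(t) = c ∑_{j=1}^{N(t)+1} (s_j - s_{j-1}) cos θ_j`. The sequence of
angles is numbered from zero: `θ j` is the angle on the interval from the `j`-th to the
`(j+1)`-st switching time. -/
noncomputable def position {Ω : Type*} (c : ℝ) (N : ℝ → Ω → ℕ) (s : ℕ → Ω → ℝ) (θ : ℕ → Ω → ℝ)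
    (t : ℝ) (ω : Ω) : ℝ :=
  c * ∑ j ∈ Finset.range (N t ω + 1),
    (switchTime N s t (j + 1) ω - switchTime N s t j ω) * Real.cos (θ j ω)

/-- `v_0 = n / 2` and `v_1 = n + 1`. -/
noncomputable def besselOrder (m : Fin 2) (n : ℕ) : ℝ :=
  if m = 0 then (n : ℝ) / 2 else (n : ℝ) + 1

/-! Put z = iα or z = β. On {N(t) = n} the first n waiting times have joint density r^n exp(-r s_n),
where r is the rate, and the next one exceeds t - s_n with probability exp(-r (t - s_n)). The weight
r^n exp(-r t) is thus constant on the simplex of piece lengths. By independence of the angles, the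
expectation of the exponential on this event is that weight times the (n+1)-fold convolution at t of
φ(u) = E exp(z c u cos θ). The case z = 0 gives the Poisson probability, and the quotient is n!/t^n
times the convolution.

The odd moments of cos θ vanish, and the even ones are `besselCoeff m 0 j`: centralBinom j / 4^j for
m = 0, catalan j / 4^j for m = 1. A convolution of u^a/a! and u^b/b! is u^(a+b+1)/(a+b+1)!, so
convolving the transforms amounts to multiplying the power series A_n with coefficients `besselCoeff
m n k`. What has to be shown is A_n = A_0^(n+1). For m = 0 this holds because A_n = (1 -
X)^(-(n+1)/2). For m = 1, A_0 is the Catalan series at X/4, which solves A_0 = 1 + (X/4) A_0^2, and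
the A_n satisfy the matching recurrence.

The main lemmas are `sum_antidiagonal_besselCoeff` (algebra), `intervalIntegral_pathTransform_mul`
(convolution), `integral_pieceProd` (waiting times) and `IsPoissonProcess.ae_indicator_exp_eq` (from
paths to vectors of pieces). -/

/-! ### Generating series of the Bessel coefficients -/

open PowerSeries in
/-- The generating series of `centralBinom k / 4 ^ k` is `(1 - X) ^ (-1 / 2)`. -/
theorem one_sub_X_mul_centralBinomSeries_sq :
    (1 - X) * (PowerSeries.mk fun k => (Nat.centralBinom k : ℝ) / 4 ^ k) ^ 2 = 1 := by
  set P : PowerSeries ℝ := PowerSeries.mk fun k => (Nat.centralBinom k : ℝ) / 4 ^ k with hP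
  -- The differential equation of (1 - X)^(-1/2); it makes the derivative of (1 - X) P^2 vanish, and
  -- the constant term is 1.
  have key : 2 * ((1 - X) * d⁄dX ℝ P) = P := by
    ext k
    rw [show 2 * ((1 - X) * d⁄dX ℝ P) = (2 : ℝ) • (d⁄dX ℝ P - X * d⁄dX ℝ P) by
      rw [smul_eq_C_mul, map_ofNat]; ring]
    rw [map_smul, map_sub]
    have h1 (k : ℕ) : 2 * ((k : ℝ) + 1) * (Nat.centralBinom (k + 1) / 4 ^ (k + 1)) =
        (2 * k + 1) * (Nat.centralBinom k / 4 ^ k) := by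
      have := Nat.succ_mul_centralBinom_succ k
      have h2 : ((k : ℝ) + 1) * Nat.centralBinom (k + 1) =
          2 * (2 * k + 1) * Nat.centralBinom k := by exact_mod_cast this
      rw [pow_succ]
      field_simp
      linarith
    cases k with
    | zero =>
      have := h1 0
      simp [hP, coeff_derivative] at this ⊢
      linarith
    | succ k =>
      have := h1 (k + 1)
      simp only [coeff_succ_X_mul, coeff_derivative, hP, coeff_mk, smul_eq_mul]
      push_cast at this ⊢
      linarith
  apply derivative.ext
  · have e : d⁄dX ℝ ((1 - X) * P ^ 2) = P * (2 * ((1 - X) * d⁄dX ℝ P)) - P ^ 2 := by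
      rw [Derivation.leibniz, Derivation.leibniz_pow, map_sub]
      simp [derivative_X, smul_eq_mul]
      ring
    rw [e, key]
    simp [pow_two]
  · have h0 : constantCoeff P = 1 := by
      rw [← coeff_zero_eq_constantCoeff_apply, hP, coeff_mk]; simp
    simp [h0]

/-- The coefficients of the characteristic function of `n + 1` pieces of the path, up to powers
of the argument. -/
noncomputable def besselCoeff (m : Fin 2) (n k : ℕ) : ℝ :=
  (n + 2 * k).factorial * Real.Gamma (besselOrder m n + 1) /
    (n.factorial * 4 ^ k * k.factorial * Real.Gamma (k + besselOrder m n + 1))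

theorem besselOrder_nonneg (m : Fin 2) (n : ℕ) : 0 ≤ besselOrder m n := by
  unfold besselOrder; split_ifs <;> positivity

theorem besselCoeff_zero_right (m : Fin 2) (n : ℕ) : besselCoeff m n 0 = 1 := by
  have := besselOrder_nonneg m n
  have h : Real.Gamma (besselOrder m n + 1) ≠ 0 := (Real.Gamma_pos_of_pos (by linarith)).ne'
  have h' : Real.Gamma ((0 : ℕ) + besselOrder m n + 1) = Real.Gamma (besselOrder m n + 1) := by
    simp
  have hn : (n.factorial : ℝ) ≠ 0 := by positivity
  rw [besselCoeff, h', Nat.mul_zero, add_zero, Nat.factorial_zero, pow_zero]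
  field_simp
  simp

/-- Coefficient form of (1 - X) A_{n+2} = A_n, as expected from A_n = (1 - X)^(-(n+1)/2). -/
theorem besselCoeff_zero_succ (n k : ℕ) :
    besselCoeff 0 (n + 2) (k + 1) = besselCoeff 0 (n + 2) k + besselCoeff 0 n (k + 1) := by
  have h1 : Real.Gamma ((n : ℝ) / 2 + 1) ≠ 0 := (Real.Gamma_pos_of_pos (by positivity)).ne'
  have h2 : Real.Gamma ((k : ℝ) + n / 2 + 2) ≠ 0 := (Real.Gamma_pos_of_pos (by positivity)).ne'
  have e1 : Real.Gamma (((n : ℝ) + 2) / 2 + 1) = (n / 2 + 1) * Real.Gamma ((n : ℝ) / 2 + 1) := by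
    rw [← Real.Gamma_add_one (by positivity)]; congr 1; ring
  have e2 : Real.Gamma ((k : ℝ) + 1 + (n + 2) / 2 + 1) =
      (k + n / 2 + 2) * Real.Gamma ((k : ℝ) + n / 2 + 2) := by
    rw [← Real.Gamma_add_one (by positivity)]; congr 1; ring
  have e3 : (k : ℝ) + (n + 2) / 2 + 1 = k + n / 2 + 2 := by ring
  have e4 : (k : ℝ) + 1 + n / 2 + 1 = k + n / 2 + 2 := by ring
  have f1 : n + 2 + 2 * (k + 1) = (n + 2 * k + 1 + 1 + 1) + 1 := by ring
  have f2 : n + 2 + 2 * k = n + 2 * k + 1 + 1 := by ring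
  have f3 : n + 2 * (k + 1) = n + 2 * k + 1 + 1 := by ring
  simp only [besselCoeff, besselOrder, if_true]
  rw [f1, f2, f3]
  simp only [Nat.factorial_succ]
  push_cast
  rw [e1, e2, e3, e4]
  field_simp
  ring

theorem besselCoeff_one (n k : ℕ) : besselCoeff 1 n k =
    (n + 2 * k).factorial * (n + 1) / (4 ^ k * k.factorial * (k + n + 1).factorial) := by
  have h1 : Real.Gamma ((n : ℝ) + 1 + 1) = (n + 1).factorial := by
    rw [← Real.Gamma_nat_eq_factorial]; push_cast; rfl
  have h2 : Real.Gamma ((k : ℝ) + (n + 1) + 1) = (k + n + 1).factorial := by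
    rw [← Real.Gamma_nat_eq_factorial]; push_cast; ring_nf
  simp only [besselCoeff, besselOrder, one_ne_zero, if_false]
  rw [h1, h2, Nat.factorial_succ]
  push_cast
  field_simp

/-- Coefficient form of A_{n+1} = A_n + (X/4) A_{n+2}, which is the Catalan equation A_0 = 1 + (X/4)
A_0^2 multiplied by A_0^(n+1) once the A_n are known to be powers. -/
theorem besselCoeff_one_succ (n k : ℕ) :
    besselCoeff 1 (n + 1) (k + 1) = besselCoeff 1 n (k + 1) + besselCoeff 1 (n + 2) k / 4 := by
  simp only [besselCoeff_one]
  have f1 : n + 1 + 2 * (k + 1) = (n + 2 * k + 1 + 1) + 1 := by ring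
  have f2 : n + 2 + 2 * k = n + 2 * k + 1 + 1 := by ring
  have f3 : n + 2 * (k + 1) = n + 2 * k + 1 + 1 := by ring
  have f4 : k + 1 + (n + 1) + 1 = (k + n + 1 + 1) + 1 := by ring
  have f5 : k + 1 + n + 1 = k + n + 1 + 1 := by ring
  have f6 : k + (n + 2) + 1 = k + n + 1 + 1 + 1 := by ring
  rw [f1, f2, f3, f4, f5, f6]
  simp only [Nat.factorial_succ]
  push_cast
  field_simp
  ring

theorem besselCoeff_zero_zero (k : ℕ) :
    besselCoeff 0 0 k = (Nat.centralBinom k : ℝ) / 4 ^ k := by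
  have h : Real.Gamma ((k : ℝ) + 1) = k.factorial := Real.Gamma_nat_eq_factorial k
  have h2 : (2 * k).factorial = Nat.centralBinom k * k.factorial * k.factorial := by
    rw [Nat.centralBinom_eq_two_mul_choose, ← Nat.choose_mul_factorial_mul_factorial
      (show k ≤ 2 * k by omega), show 2 * k - k = k by omega]
  simp only [besselCoeff, besselOrder, if_true]
  simp only [CharP.cast_eq_zero, zero_div, zero_add, Real.Gamma_one, Nat.factorial_zero, add_zero, h,
    h2]
  push_cast
  field_simp

theorem besselCoeff_zero_one (k : ℕ) : besselCoeff 0 1 k = 1 := by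
  induction k with
  | zero => exact besselCoeff_zero_right 0 1
  | succ k ih =>
    rw [← ih]
    have h1 : Real.Gamma ((k : ℝ) + 1 / 2 + 1) ≠ 0 := (Real.Gamma_pos_of_pos (by positivity)).ne'
    have e1 : Real.Gamma ((k : ℝ) + 1 + 1 / 2 + 1) =
        (k + 1 / 2 + 1) * Real.Gamma ((k : ℝ) + 1 / 2 + 1) := by
      rw [← Real.Gamma_add_one (by positivity)]; congr 1; ring
    have f1 : 1 + 2 * (k + 1) = (1 + 2 * k + 1) + 1 := by ring
    simp only [besselCoeff, besselOrder, if_true]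
    rw [f1]
    simp only [Nat.factorial_succ]
    push_cast
    rw [e1]
    field_simp
    ring

theorem besselCoeff_one_zero (k : ℕ) : besselCoeff 1 0 k = (catalan k : ℝ) / 4 ^ k := by
  have h := besselCoeff_zero_zero k
  have h2 : ((k : ℝ) + 1) * catalan k = Nat.centralBinom k := by
    exact_mod_cast succ_mul_catalan_eq_centralBinom k
  have h3 : Real.Gamma ((k : ℝ) + 1) = k.factorial := Real.Gamma_nat_eq_factorial k
  rw [← h2] at h
  rw [besselCoeff_one]
  simp only [besselCoeff, besselOrder, if_true] at h
  simp only [CharP.cast_eq_zero, zero_div, zero_add, Real.Gamma_one, Nat.factorial_zero, add_zero,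
    h3] at h
  simp only [zero_add, add_zero, Nat.factorial_succ, CharP.cast_eq_zero]
  push_cast at h ⊢
  have : (k.factorial : ℝ) ≠ 0 := by positivity
  field_simp at h ⊢
  linarith

open PowerSeries in
theorem mk_besselCoeff_zero_add_two (n : ℕ) :
    (1 - X) * PowerSeries.mk (besselCoeff 0 (n + 2)) = PowerSeries.mk (besselCoeff 0 n) := by
  ext k
  rw [sub_mul, one_mul, map_sub]
  cases k with
  | zero => simp [besselCoeff_zero_right]
  | succ k =>
    rw [coeff_succ_X_mul, coeff_mk, coeff_mk, coeff_mk, besselCoeff_zero_succ]; ring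

open PowerSeries in
theorem mk_besselCoeff_one_add_one (n : ℕ) :
    PowerSeries.mk (besselCoeff 1 (n + 1)) = PowerSeries.mk (besselCoeff 1 n) +
      C (1 / 4 : ℝ) * (X * PowerSeries.mk (besselCoeff 1 (n + 2))) := by
  ext k
  rw [map_add, coeff_C_mul]
  cases k with
  | zero => simp [besselCoeff_zero_right]
  | succ k =>
    rw [coeff_succ_X_mul, coeff_mk, coeff_mk, coeff_mk, besselCoeff_one_succ]; ring

theorem mk_besselCoeff_zero (n : ℕ) :
    PowerSeries.mk (besselCoeff 0 n) = PowerSeries.mk (besselCoeff 0 0) ^ (n + 1) := by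
  have h0 : (1 - PowerSeries.X) * PowerSeries.mk (besselCoeff 0 0) ^ 2 = 1 := by
    rw [show besselCoeff 0 0 = fun k => (Nat.centralBinom k : ℝ) / 4 ^ k from
      funext besselCoeff_zero_zero]
    exact one_sub_X_mul_centralBinomSeries_sq
  have hne : (1 - PowerSeries.X : PowerSeries ℝ) ≠ 0 := by
    intro h; rw [h, zero_mul] at h0; exact zero_ne_one h0
  induction n using Nat.twoStepInduction with
  | zero => simp
  -- A_1 is the geometric series, so (1 - X) A_1 = 1 = (1 - X) A_0^2.
  | one =>
    apply mul_left_cancel₀ hne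
    rw [h0]
    ext k
    rw [sub_mul, one_mul, map_sub]
    cases k with
    | zero => simp [besselCoeff_zero_right]
    | succ k =>
      rw [PowerSeries.coeff_succ_X_mul, PowerSeries.coeff_mk, PowerSeries.coeff_mk,
        besselCoeff_zero_one, besselCoeff_zero_one]
      simp [PowerSeries.coeff_one]
  | more n ih _ =>
    apply mul_left_cancel₀ hne
    rw [mk_besselCoeff_zero_add_two, ih,
      show ∀ P : PowerSeries ℝ, (1 - PowerSeries.X) * P ^ (n + 2 + 1) =
        ((1 - PowerSeries.X) * P ^ 2) * P ^ (n + 1) from fun P => by ring, h0, one_mul]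

theorem mk_besselCoeff_one (n : ℕ) :
    PowerSeries.mk (besselCoeff 1 n) = PowerSeries.mk (besselCoeff 1 0) ^ (n + 1) := by
  have hX : (PowerSeries.C (1 / 4 : ℝ) * PowerSeries.X : PowerSeries ℝ) ≠ 0 := by
    refine mul_ne_zero ?_ PowerSeries.X_ne_zero
    simp
  have h0 : PowerSeries.mk (besselCoeff 1 0) = 1 + PowerSeries.C (1 / 4 : ℝ) * PowerSeries.X *
      PowerSeries.mk (besselCoeff 1 0) ^ 2 := by
    ext k
    rw [map_add, mul_assoc, PowerSeries.coeff_C_mul]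
    cases k with
    | zero => simp [besselCoeff_zero_right]
    | succ k =>
      rw [PowerSeries.coeff_succ_X_mul, pow_two, PowerSeries.coeff_mul]
      simp only [PowerSeries.coeff_mk, besselCoeff_one_zero, PowerSeries.coeff_one]
      -- The convolution recurrence of the Catalan numbers is the quadratic equation `h0` read off
      -- coefficientwise.
      rw [catalan_succ', Nat.cast_sum, Finset.sum_div, if_neg (by omega), zero_add, Finset.mul_sum]
      refine Finset.sum_congr rfl fun x hx => ?_
      rw [← Finset.HasAntidiagonal.mem_antidiagonal.1 hx, pow_succ, pow_add]
      push_cast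
      field_simp
  induction n using Nat.twoStepInduction with
  | zero => simp
  | one =>
    -- The recurrence continued one index down, with A_{-1} = 1; comparison with `h0` and
    -- cancellation of X/4 give A_1 = A_0^2.
    have h1 : PowerSeries.mk (besselCoeff 1 0) = 1 + PowerSeries.C (1 / 4 : ℝ) * PowerSeries.X *
        PowerSeries.mk (besselCoeff 1 1) := by
      ext k
      rw [map_add, mul_assoc, PowerSeries.coeff_C_mul]
      cases k with
      | zero => simp [besselCoeff_zero_right]
      | succ k =>
        rw [PowerSeries.coeff_succ_X_mul]
        simp only [PowerSeries.coeff_mk, PowerSeries.coeff_one, besselCoeff_one]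
        rw [if_neg (by omega), zero_add, zero_add, show 2 * (k + 1) = (1 + 2 * k) + 1 by ring,
          show k + 1 + 0 + 1 = k + 1 + 1 by ring, Nat.factorial_succ (1 + 2 * k),
          Nat.factorial_succ k]
        push_cast
        field_simp
        ring
    apply mul_left_cancel₀ hX
    linear_combination h0 - h1
  | more n ih ih' =>
    apply mul_left_cancel₀ hX
    have := mk_besselCoeff_one_add_one n
    rw [ih, ih', ← mul_assoc] at this
    linear_combination PowerSeries.mk (besselCoeff 1 0) ^ (n + 1) * h0 - this

/-- The law A_0 A_n = A_{n+1}, in the Cauchy-product form that the convolution integral produces. -/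
theorem sum_antidiagonal_besselCoeff (m : Fin 2) (n k : ℕ) :
    ∑ x ∈ Finset.HasAntidiagonal.antidiagonal k, besselCoeff m 0 x.1 * besselCoeff m n x.2 =
      besselCoeff m (n + 1) k := by
  have h (n : ℕ) :
      PowerSeries.mk (besselCoeff m n) = PowerSeries.mk (besselCoeff m 0) ^ (n + 1) := by
    fin_cases m
    · exact mk_besselCoeff_zero n
    · exact mk_besselCoeff_one n
  have h2 : PowerSeries.mk (besselCoeff m (n + 1)) =
      PowerSeries.mk (besselCoeff m 0) * PowerSeries.mk (besselCoeff m n) := by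
    rw [h (n + 1), h n]; ring
  have h3 := congrArg (PowerSeries.coeff k) h2
  rw [PowerSeries.coeff_mul] at h3
  simpa using h3.symm

/-! ### Moments of the cosine of an angle -/

theorem integral_cos_pow_zero_pi (k : ℕ) :
    ∫ x in (0 : ℝ)..Real.pi, Real.cos x ^ (k + 2) =
      (k + 1) / (k + 2) * ∫ x in (0 : ℝ)..Real.pi, Real.cos x ^ k := by
  rw [integral_cos_pow]; simp

theorem integral_cos_pow_odd_zero_pi (j : ℕ) :
    ∫ x in (0 : ℝ)..Real.pi, Real.cos x ^ (2 * j + 1) = 0 := by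
  induction j with
  | zero => simp
  | succ j ih =>
    rw [show 2 * (j + 1) + 1 = (2 * j + 1) + 2 by ring, integral_cos_pow_zero_pi, ih, mul_zero]

theorem integral_cos_pow_even_zero_pi (j : ℕ) :
    ∫ x in (0 : ℝ)..Real.pi, Real.cos x ^ (2 * j) = Real.pi * (Nat.centralBinom j / 4 ^ j) := by
  induction j with
  | zero => simp
  | succ j ih =>
    have h : ((j : ℝ) + 1) * Nat.centralBinom (j + 1) = 2 * (2 * j + 1) * Nat.centralBinom j := by
      exact_mod_cast Nat.succ_mul_centralBinom_succ j
    have h2 : (Nat.centralBinom (j + 1) : ℝ) =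
        2 * (2 * j + 1) * Nat.centralBinom j / (j + 1) := by
      rw [eq_div_iff (by positivity)]; linarith
    rw [show 2 * (j + 1) = (2 * j) + 2 by ring, integral_cos_pow_zero_pi, ih, h2, pow_succ]
    push_cast
    field_simp
    ring

theorem Real.Gamma_one_add_one_half : Real.Gamma (1 + 1 / 2) = √Real.pi / 2 := by
  rw [add_comm, Real.Gamma_add_one (by norm_num), Real.Gamma_one_half_eq]; ring

theorem integral_angleLaw (m : Fin 2) (f : ℝ → ℝ) :
    ∫ x, f x ∂(angleLaw ((m : ℕ) : ℝ)) = ((m : ℕ) + 1) / Real.pi *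
      ∫ x in (0 : ℝ)..Real.pi, Real.sin x ^ (2 * (m : ℕ)) * f x := by
  have hπ := Real.pi_pos
  have hs : √Real.pi * √Real.pi = Real.pi := Real.mul_self_sqrt hπ.le
  rw [angleLaw, integral_withDensity_eq_integral_toReal_smul (by fun_prop) (by simp),
    intervalIntegral.integral_of_le hπ.le, ← integral_Ioc_eq_integral_Ioo, ← integral_const_mul]
  refine setIntegral_congr_fun measurableSet_Ioc fun x hx => ?_
  have hsin : 0 ≤ Real.sin x := Real.sin_nonneg_of_nonneg_of_le_pi hx.1.le hx.2
  -- The values Γ(1/2) = √π and Γ(3/2) = √π/2 give the constants 1/π and 2/π.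
  have hK : Real.Gamma ((m : ℕ) + 1) / (√Real.pi * Real.Gamma ((m : ℕ) + 1 / 2)) =
      ((m : ℕ) + 1) / Real.pi := by
    fin_cases m
    · simp [Real.Gamma_one_half_eq, hs, -one_div]
    · simp only [Nat.cast_one, Real.Gamma_one_add_one_half, one_add_one_eq_two, Real.Gamma_two]
      rw [← mul_div_assoc, hs]
      simp
  have hr : Real.sin x ^ (2 * ((m : ℕ) : ℝ)) = Real.sin x ^ (2 * (m : ℕ)) := by
    rw [← Real.rpow_natCast]; push_cast; rfl
  simp only [smul_eq_mul]
  rw [hK, hr, ENNReal.toReal_ofReal (by positivity)]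
  ring

theorem integral_cos_pow_odd_angleLaw (m : Fin 2) (j : ℕ) :
    ∫ x, Real.cos x ^ (2 * j + 1) ∂(angleLaw ((m : ℕ) : ℝ)) = 0 := by
  rw [integral_angleLaw]
  fin_cases m
  · simp [integral_cos_pow_odd_zero_pi]
  · have h (x : ℝ) : Real.sin x ^ (2 * 1) * Real.cos x ^ (2 * j + 1) =
        Real.cos x ^ (2 * j + 1) - Real.cos x ^ (2 * (j + 1) + 1) := by
      rw [mul_one, Real.sin_sq]; ring
    simp only [h]
    rw [intervalIntegral.integral_sub (Continuous.intervalIntegrable (by fun_prop) _ _)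
      (Continuous.intervalIntegrable (by fun_prop) _ _), integral_cos_pow_odd_zero_pi,
      integral_cos_pow_odd_zero_pi]
    simp

theorem integral_cos_pow_even_angleLaw (m : Fin 2) (j : ℕ) :
    ∫ x, Real.cos x ^ (2 * j) ∂(angleLaw ((m : ℕ) : ℝ)) = besselCoeff m 0 j := by
  have hπ := Real.pi_pos.ne'
  rw [integral_angleLaw]
  fin_cases m
  · have := besselCoeff_zero_zero j
    simp only [Fin.zero_eta] at *
    simp [integral_cos_pow_even_zero_pi, this]
  · have h (x : ℝ) : Real.sin x ^ (2 * 1) * Real.cos x ^ (2 * j) =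
        Real.cos x ^ (2 * j) - Real.cos x ^ (2 * j + 2) := by
      rw [mul_one, Real.sin_sq]; ring
    have h2 : ((j : ℝ) + 1) * catalan j = Nat.centralBinom j := by
      exact_mod_cast succ_mul_catalan_eq_centralBinom j
    have h3 := besselCoeff_one_zero j
    simp only [Fin.mk_one, h]
    rw [intervalIntegral.integral_sub (Continuous.intervalIntegrable (by fun_prop) _ _)
      (Continuous.intervalIntegrable (by fun_prop) _ _), integral_cos_pow_zero_pi,
      integral_cos_pow_even_zero_pi, h3, ← h2]
    push_cast
    field_simp
    ring

theorem hasSum_integral_exp_mul_cos (ρ : Measure ℝ) [IsProbabilityMeasure ρ] (z : ℂ) :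
    HasSum (fun k : ℕ => ((∫ x, Real.cos x ^ k ∂ρ : ℝ) : ℂ) * z ^ k / k.factorial)
      (∫ x, Complex.exp (z * Real.cos x) ∂ρ) := by
  have h (k : ℕ) : ((∫ x, Real.cos x ^ k ∂ρ : ℝ) : ℂ) * z ^ k / k.factorial =
      ∫ x, (z * (Real.cos x : ℂ)) ^ k / k.factorial ∂ρ := by
    rw [← integral_complex_ofReal, ← integral_mul_const, ← integral_div]
    congr 1; ext x; push_cast; ring
  simp only [h]
  refine hasSum_integral_of_dominated_convergence (fun k _ => ‖z‖ ^ k / k.factorial)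
    (fun k => (Continuous.aestronglyMeasurable (by fun_prop))) (fun k => .of_forall fun x => ?_)
    (.of_forall fun x => Real.summable_pow_div_factorial _) (integrable_const _)
    (.of_forall fun x => ?_)
  · rw [norm_div, norm_pow, norm_mul, Complex.norm_natCast, Complex.norm_real, Real.norm_eq_abs]
    gcongr
    exact mul_le_of_le_one_right (norm_nonneg _) (Real.abs_cos_le_one x)
  · rw [Complex.exp_eq_exp_ℂ]
    exact NormedSpace.expSeries_div_hasSum_exp _

/-- The characteristic function (at a complex argument) of the projection of a unit step. -/
noncomputable def stepTransform (m : Fin 2) (z : ℂ) : ℂ :=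
  ∫ x, Complex.exp (z * Real.cos x) ∂(angleLaw ((m : ℕ) : ℝ))

theorem hasSum_stepTransform (m : Fin 2) [IsProbabilityMeasure (angleLaw ((m : ℕ) : ℝ))] (z : ℂ) :
    HasSum (fun j : ℕ => (besselCoeff m 0 j : ℂ) * z ^ (2 * j) / (2 * j).factorial)
      (stepTransform m z) := by
  have h := hasSum_integral_exp_mul_cos (angleLaw ((m : ℕ) : ℝ)) z
  have hinj : Function.Injective (fun j : ℕ => 2 * j) := fun a b h => by simpa using h
  rw [← hinj.hasSum_iff] at h
  · simpa only [stepTransform, Function.comp_def, integral_cos_pow_even_angleLaw] using h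
  · intro k hk
    obtain ⟨j, rfl⟩ : Odd k := by
      rw [← Nat.not_even_iff_odd]
      rintro ⟨r, rfl⟩
      exact hk ⟨r, by ring⟩
    rw [integral_cos_pow_odd_angleLaw]
    simp

/-! ### Convolution of the transforms -/

theorem integral_pow_mul_sub_pow_div_factorial (a b : ℕ) {u : ℝ} (hu : 0 < u) :
    ∫ w in (0 : ℝ)..u, ((w : ℂ) ^ a / a.factorial) * (((u - w : ℝ) : ℂ) ^ b / b.factorial) =
      (u : ℂ) ^ (a + b + 1) / (a + b + 1).factorial := by
  have h := Complex.betaIntegral_scaled (a + 1 : ℂ) (b + 1) hu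
  have h2 := Complex.Gamma_mul_Gamma_eq_betaIntegral (s := a + 1) (t := b + 1)
    (by simp; positivity) (by simp; positivity)
  have e : (a : ℂ) + 1 + (b + 1) = ((a + b + 1 : ℕ) : ℂ) + 1 := by push_cast; ring
  have e2 : (a : ℂ) + 1 + (b + 1) - 1 = ((a + b + 1 : ℕ) : ℂ) := by push_cast; ring
  rw [e2] at h
  rw [e, Complex.Gamma_nat_eq_factorial, Complex.Gamma_nat_eq_factorial,
    Complex.Gamma_nat_eq_factorial] at h2
  simp only [add_sub_cancel_right, Complex.cpow_natCast] at h
  have hf (k : ℕ) : (k.factorial : ℂ) ≠ 0 := by exact_mod_cast k.factorial_ne_zero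
  have h3 (w : ℝ) : ((w : ℂ) ^ a / a.factorial) * (((u - w : ℝ) : ℂ) ^ b / b.factorial) =
      ((w : ℂ) ^ a * (u - w) ^ b) / (a.factorial * b.factorial) := by
    push_cast; field_simp
  simp only [h3]
  rw [intervalIntegral.integral_div, h]
  have hB : Complex.betaIntegral (a + 1) (b + 1) =
      (a.factorial * b.factorial) / (a + b + 1).factorial := by
    rw [h2]; field_simp [hf]
  rw [hB]
  field_simp [hf]

theorem HasSum.mul_complex {f g : ℕ → ℂ} {a b : ℂ} (hf : HasSum f a) (hg : HasSum g b) :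
    HasSum (fun x : ℕ × ℕ => f x.1 * g x.2) (a * b) := by
  have h : Summable fun x : ℕ × ℕ => f x.1 * g x.2 :=
    summable_mul_of_summable_norm hf.summable.norm hg.summable.norm
  exact hf.mul hg h

/-- The factorial (n + 2k)! cancels, and Γ(v + 1) ≤ Γ(k + v + 1) because Γ(x + 1) = x Γ(x) with x ≥
1. The series of `pathTransform` is thereby dominated by an exponential series in |z u|^2. -/
theorem norm_besselCoeff_div_factorial_le (m : Fin 2) (n k : ℕ) :
    ‖((besselCoeff m n k : ℝ) : ℂ) / ((n + 2 * k).factorial : ℂ)‖ ≤ 1 / k.factorial := by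
  have hv := besselOrder_nonneg m n
  have hpos : 0 < Real.Gamma (besselOrder m n + 1) := Real.Gamma_pos_of_pos (by linarith)
  have hpos' : 0 < Real.Gamma (k + besselOrder m n + 1) := Real.Gamma_pos_of_pos (by positivity)
  have hmono : Real.Gamma (besselOrder m n + 1) ≤ Real.Gamma (k + besselOrder m n + 1) := by
    clear hpos'
    induction k with
    | zero => simp
    | succ k ih =>
      refine ih.trans ?_
      have h1 : 0 < Real.Gamma (k + besselOrder m n + 1) := hpos.trans_le ih
      have hk : (0 : ℝ) ≤ k := Nat.cast_nonneg k
      rw [show ((k + 1 : ℕ) : ℝ) + besselOrder m n + 1 = (k + besselOrder m n + 1) + 1 by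
        push_cast; ring, Real.Gamma_add_one (s := (k : ℝ) + besselOrder m n + 1) (by linarith)]
      exact le_mul_of_one_le_left h1.le (by linarith)
  have e : ((besselCoeff m n k : ℝ) : ℂ) / ((n + 2 * k).factorial : ℂ) =
      ((Real.Gamma (besselOrder m n + 1) / Real.Gamma (k + besselOrder m n + 1) /
        (n.factorial * 4 ^ k) / k.factorial : ℝ) : ℂ) := by
    rw [besselCoeff]
    have hf (k : ℕ) : (k.factorial : ℂ) ≠ 0 := by exact_mod_cast k.factorial_ne_zero
    have hc : ((Real.Gamma (k + besselOrder m n + 1) : ℝ) : ℂ) ≠ 0 := by exact_mod_cast hpos'.ne'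
    push_cast
    field_simp [hf]
  rw [e, Complex.norm_real, Real.norm_of_nonneg (by positivity)]
  gcongr
  have h1 : Real.Gamma (besselOrder m n + 1) / Real.Gamma (k + besselOrder m n + 1) ≤ 1 :=
    (div_le_one hpos').2 hmono
  have h2 : (1 : ℝ) ≤ n.factorial * 4 ^ k := by
    have : (1 : ℝ) ≤ n.factorial := by exact_mod_cast n.factorial_pos
    have : (1 : ℝ) ≤ 4 ^ k := one_le_pow₀ (by norm_num)
    nlinarith
  exact (div_le_one (by positivity)).2 (h1.trans h2)

/-- The integral of the product of the transforms of `n + 1` steps over the simplex of step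
lengths with sum `u`. -/
noncomputable def pathTransform (m : Fin 2) (n : ℕ) (z : ℂ) (u : ℝ) : ℂ :=
  ∑' k : ℕ, (besselCoeff m n k : ℂ) * z ^ (2 * k) * ((u : ℂ) ^ (n + 2 * k) / (n + 2 * k).factorial)

theorem hasSum_pathTransform (m : Fin 2) (n : ℕ) (z : ℂ) (u : ℝ) :
    HasSum (fun k : ℕ => (besselCoeff m n k : ℂ) * z ^ (2 * k) *
      ((u : ℂ) ^ (n + 2 * k) / (n + 2 * k).factorial)) (pathTransform m n z u) := by
  refine Summable.hasSum (Summable.of_norm_bounded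
    ((Real.summable_pow_div_factorial (‖z * u‖ ^ 2)).mul_left (‖(u : ℂ)‖ ^ n)) fun k => ?_)
  have e : (besselCoeff m n k : ℂ) * z ^ (2 * k) * ((u : ℂ) ^ (n + 2 * k) / (n + 2 * k).factorial) =
      (u : ℂ) ^ n * ((z * u) ^ 2) ^ k * ((besselCoeff m n k : ℂ) / (n + 2 * k).factorial) := by
    rw [← pow_mul, mul_pow, pow_add]; ring
  rw [e, norm_mul, norm_mul, norm_pow, norm_pow, norm_pow]
  calc _ ≤ ‖(u : ℂ)‖ ^ n * (‖z * u‖ ^ 2) ^ k * (1 / k.factorial) := by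
        gcongr; exact norm_besselCoeff_div_factorial_le m n k
    _ = _ := by ring

theorem pathTransform_zero (m : Fin 2) [IsProbabilityMeasure (angleLaw ((m : ℕ) : ℝ))] (z : ℂ)
    (u : ℝ) : pathTransform m 0 z u = stepTransform m (z * u) := by
  refine (hasSum_pathTransform m 0 z u).unique ?_
  convert hasSum_stepTransform m (z * u) using 2 with k
  rw [zero_add, mul_pow]; ring

/-- Both series are multiplied out and integrated termwise by the beta integral; the terms with a
given total degree in z then add up by `sum_antidiagonal_besselCoeff`. -/
theorem intervalIntegral_pathTransform_mul (m : Fin 2) (n : ℕ) (z : ℂ) {u : ℝ} (hu : 0 ≤ u) :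
    ∫ w in (0 : ℝ)..u, pathTransform m 0 z w * pathTransform m n z (u - w) =
      pathTransform m (n + 1) z u := by
  rcases hu.eq_or_lt with rfl | hu
  -- The scaled beta integral needs u > 0. At u = 0 every term on the right carries a positive power
  -- of u.
  · have := hasSum_pathTransform m (n + 1) z 0
    have h0 : ∀ k, (n + 1 + 2 * k) ≠ 0 := fun k => by omega
    simp only [Complex.ofReal_zero, zero_pow (h0 _), zero_div, mul_zero] at this
    rw [intervalIntegral.integral_same]
    exact hasSum_zero.unique this
  obtain ⟨T, T_def⟩ : ∃ T : ℕ → ℕ → ℝ → ℂ, T = fun n k (w : ℝ) => (besselCoeff m n k : ℂ) *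
    z ^ (2 * k) * ((w : ℂ) ^ (n + 2 * k) / (n + 2 * k).factorial) := ⟨_, rfl⟩
  have hT (n : ℕ) (w : ℝ) : HasSum (fun k => T n k w) (pathTransform m n z w) := by
    rw [T_def]; exact hasSum_pathTransform m n z w
  have hTm (n k : ℕ) {w : ℝ} (h0 : 0 ≤ w) (h1 : w ≤ u) : ‖T n k w‖ ≤ ‖T n k u‖ := by
    simp only [T_def, norm_mul, norm_div, norm_pow, Complex.norm_real, Real.norm_of_nonneg h0,
      Real.norm_of_nonneg hu.le]
    gcongr
  have hsum (n : ℕ) (w : ℝ) : Summable fun k => ‖T n k w‖ := (hT n w).summable.norm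
  have hprod (w : ℝ) : HasSum (fun x : ℕ × ℕ => T 0 x.1 w * T n x.2 (u - w))
      (pathTransform m 0 z w * pathTransform m n z (u - w)) :=
    HasSum.mul_complex (f := fun k => T 0 k w) (g := fun k => T n k (u - w)) (hT 0 w) (hT n (u - w))
  have hsw : HasSum (fun x : ℕ × ℕ => ∫ w in (0 : ℝ)..u, T 0 x.1 w * T n x.2 (u - w))
      (∫ w in (0 : ℝ)..u, pathTransform m 0 z w * pathTransform m n z (u - w)) := by
    refine intervalIntegral.hasSum_integral_of_dominated_convergence
      (fun x _ => ‖T 0 x.1 u‖ * ‖T n x.2 u‖) (fun x => ?_) (fun x => .of_forall fun w hw => ?_)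
      (.of_forall fun w _ => ?_) intervalIntegrable_const (.of_forall fun w _ => ?_)
    · exact Continuous.aestronglyMeasurable (by simp only [T_def]; fun_prop)
    · rw [Set.uIoc_of_le hu.le] at hw
      rw [norm_mul]
      gcongr
      · exact hTm _ _ hw.1.le hw.2
      · exact hTm _ _ (by linarith [hw.2]) (by linarith [hw.1])
    · simpa only [norm_mul] using (hsum 0 u).mul_norm (hsum n u)
    · exact hprod w
  have hval (x : ℕ × ℕ) : ∫ w in (0 : ℝ)..u, T 0 x.1 w * T n x.2 (u - w) =
      ((besselCoeff m 0 x.1 * besselCoeff m n x.2 : ℝ) : ℂ) * z ^ (2 * (x.1 + x.2)) *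
        ((u : ℂ) ^ (n + 1 + 2 * (x.1 + x.2)) / (n + 1 + 2 * (x.1 + x.2)).factorial) := by
    have h := integral_pow_mul_sub_pow_div_factorial (0 + 2 * x.1) (n + 2 * x.2) hu
    rw [show 0 + 2 * x.1 + (n + 2 * x.2) + 1 = n + 1 + 2 * (x.1 + x.2) by ring] at h
    rw [← h, ← intervalIntegral.integral_const_mul]
    congr 1; ext w
    simp only [T_def]
    push_cast
    ring
  simp only [hval] at hsw
  rw [← Finset.HasAntidiagonal.sigmaAntidiagonalEquivProd.hasSum_iff] at hsw
  have hsig := hsw.sigma fun k => hasSum_fintype _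
  refine hsig.unique ?_
  convert hasSum_pathTransform m (n + 1) z u using 2 with k
  rw [← sum_antidiagonal_besselCoeff, Complex.ofReal_sum, Finset.sum_mul, Finset.sum_mul,
    Finset.univ_eq_attach, ← Finset.sum_attach (Finset.HasAntidiagonal.antidiagonal k)]
  refine Finset.sum_congr rfl fun x _ => ?_
  have hx := Finset.HasAntidiagonal.mem_antidiagonal.1 x.2
  simp [Finset.HasAntidiagonal.sigmaAntidiagonalEquivProd, hx]

/-! ### Cutting the time interval into pieces -/

/-- The lengths `w 0, …, w (n - 1), t - ∑ i < n, w i` of the `n + 1` pieces into which `[0, t]` is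
cut by `n` consecutive waiting times. -/
noncomputable def pieces (n : ℕ) (t : ℝ) (w : Fin (n + 1) → ℝ) : Fin (n + 1) → ℝ :=
  Fin.snoc (α := fun _ => ℝ) (fun i : Fin n => w i.castSucc) (t - ∑ i : Fin n, w i.castSucc)

theorem pieces_cons (n : ℕ) (t x : ℝ) (w : Fin (n + 1) → ℝ) :
    pieces (n + 1) t (Fin.cons x w : Fin (n + 2) → ℝ) = Fin.cons x (pieces n (t - x) w) := by
  have h : (fun i : Fin (n + 1) => (Fin.cons x w : Fin (n + 2) → ℝ) i.castSucc) =
      Fin.cons x (fun i : Fin n => w i.castSucc) := by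
    ext i
    refine Fin.cases ?_ (fun j => ?_) i
    · simp
    · simp
  unfold pieces
  rw [h, Fin.cons_snoc_eq_snoc_cons, Fin.sum_cons, sub_add_eq_sub_sub]

theorem sum_pieces (n : ℕ) (t : ℝ) (w : Fin (n + 1) → ℝ) : ∑ i, pieces n t w i = t := by
  simp [Fin.sum_univ_castSucc, pieces]

theorem measurable_pieces (n : ℕ) (t : ℝ) (i : Fin (n + 1)) :
    Measurable fun w : Fin (n + 1) → ℝ => pieces n t w i := by
  refine Fin.lastCases ?_ (fun j => ?_) i
  · simp only [pieces, Fin.snoc_last]; fun_prop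
  · simp only [pieces, Fin.snoc_castSucc]; fun_prop

/-- The vectors of waiting times for which exactly `n` events occur up to time `t`. -/
def pieceSet (n : ℕ) (t : ℝ) : Set (Fin (n + 1) → ℝ) :=
  {w | (∀ i, 0 ≤ pieces n t w i) ∧ pieces n t w (Fin.last n) < w (Fin.last n)}

theorem measurableSet_pieceSet (n : ℕ) (t : ℝ) : MeasurableSet (pieceSet n t) := by
  have := measurable_pieces n t
  have h : pieceSet n t = (⋂ i, {w | 0 ≤ pieces n t w i}) ∩
      {w | pieces n t w (Fin.last n) < w (Fin.last n)} := by
    ext; simp [pieceSet]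
  rw [h]
  exact (MeasurableSet.iInter fun i => measurableSet_le measurable_const (this i)).inter
    (measurableSet_lt (this _) (measurable_pi_apply _))

/-- Renewal at the first event: after a wait x, the same situation remains with n events and time t
- x. The induction in `integral_pieceProd` rests on this. -/
theorem cons_mem_pieceSet (n : ℕ) (t x : ℝ) (w : Fin (n + 1) → ℝ) :
    (Fin.cons x w : Fin (n + 2) → ℝ) ∈ pieceSet (n + 1) t ↔ 0 ≤ x ∧ w ∈ pieceSet n (t - x) := by
  simp only [pieceSet, Set.mem_ofPred_eq, pieces_cons, Fin.forall_fin_succ (n := n + 1),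
    Fin.cons_zero, Fin.cons_succ, ← Fin.succ_last, and_assoc]

theorem nonneg_of_mem_pieceSet {n : ℕ} {t : ℝ} {w : Fin (n + 1) → ℝ} (h : w ∈ pieceSet n t) :
    0 ≤ t := by
  rw [← sum_pieces n t w]; exact Finset.sum_nonneg fun i _ => h.1 i

/-- The product of the values of `ψ` at the lengths of the pieces of `[0, t]`. -/
noncomputable def pieceProd (ψ : ℝ → ℂ) (n : ℕ) (t : ℝ) : (Fin (n + 1) → ℝ) → ℂ :=
  (pieceSet n t).indicator fun w => ∏ i, ψ (pieces n t w i)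

theorem pieceProd_cons (ψ : ℝ → ℂ) (n : ℕ) (t x : ℝ) (w : Fin (n + 1) → ℝ) :
    pieceProd ψ (n + 1) t (Fin.cons x w : Fin (n + 2) → ℝ) =
      (Set.Ici 0).indicator (fun x => ψ x * pieceProd ψ n (t - x) w) x := by
  by_cases hx : 0 ≤ x
  · by_cases hw : w ∈ pieceSet n (t - x)
    · rw [pieceProd, Set.indicator_of_mem ((cons_mem_pieceSet n t x w).2 ⟨hx, hw⟩),
        Set.indicator_of_mem (Set.mem_Ici.2 hx), pieceProd, Set.indicator_of_mem hw, pieces_cons,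
        Fin.prod_univ_succ]
      simp
    · rw [pieceProd, Set.indicator_of_notMem fun h => hw ((cons_mem_pieceSet n t x w).1 h).2,
        Set.indicator_of_mem (Set.mem_Ici.2 hx), pieceProd, Set.indicator_of_notMem hw, mul_zero]
  · rw [pieceProd, Set.indicator_of_notMem fun h => hx ((cons_mem_pieceSet n t x w).1 h).1,
      Set.indicator_of_notMem (show x ∉ Set.Ici 0 from hx)]

theorem measurable_pieceProd {ψ : ℝ → ℂ} (hψ : Measurable ψ) (n : ℕ) (t : ℝ) :
    Measurable (pieceProd ψ n t) :=
  (Finset.measurable_fun_prod _ fun i _ => hψ.comp (measurable_pieces n t i)).indicator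
    (measurableSet_pieceSet n t)

theorem norm_pieceProd_le {ψ : ℝ → ℂ} {a : ℝ} (hψ : ∀ x, 0 ≤ x → ‖ψ x‖ ≤ Real.exp (a * x)) (n : ℕ)
    (t : ℝ) (w : Fin (n + 1) → ℝ) : ‖pieceProd ψ n t w‖ ≤ Real.exp (a * t) := by
  refine (norm_indicator_eq_indicator_norm _ _).trans_le (Set.indicator_apply_le' (fun hw => ?_)
    fun _ => (Real.exp_pos _).le)
  calc ‖∏ i, ψ (pieces n t w i)‖ = ∏ i, ‖ψ (pieces n t w i)‖ := norm_prod _ _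
    _ ≤ ∏ i, Real.exp (a * pieces n t w i) :=
        Finset.prod_le_prod (fun _ _ => norm_nonneg _) fun i _ => hψ _ (hw.1 i)
    _ = Real.exp (a * t) := by rw [← Real.exp_sum, ← Finset.mul_sum, sum_pieces]

/-! ### Integration over the waiting times -/

theorem integral_expMeasure {r : ℝ} (hr : 0 < r) (f : ℝ → ℂ) :
    ∫ x, f x ∂(expMeasure r) = ∫ x in Set.Ioi 0, (r * Real.exp (-(r * x)) : ℝ) * f x := by
  have h : expMeasure r = volume.withDensity fun x => ENNReal.ofReal (exponentialPDFReal r x) := rfl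
  rw [h, integral_withDensity_eq_integral_toReal_smul
    (measurable_exponentialPDFReal r).ennreal_ofReal (.of_forall fun _ => ENNReal.ofReal_lt_top),
    ← integral_Ici_eq_integral_Ioi, ← integral_indicator measurableSet_Ici]
  congr 1; ext x
  change (exponentialPDF r x).toReal • f x = _
  rw [exponentialPDF_eq]
  by_cases hx : 0 ≤ x
  · rw [if_pos hx, Set.indicator_of_mem (Set.mem_Ici.2 hx), ENNReal.toReal_ofReal (by positivity),
      Complex.real_smul]
  · rw [if_neg hx, Set.indicator_of_notMem (show x ∉ Set.Ici 0 from hx)]; simp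

/-- Integrating over the first coordinate of a finite product separately. -/
theorem integral_pi_succ {n : ℕ} (ρ : Measure ℝ) [IsProbabilityMeasure ρ]
    {f : (Fin (n + 2) → ℝ) → ℂ} (hf : Measurable f) {C : ℝ} (hC : ∀ w, ‖f w‖ ≤ C) :
    ∫ w, f w ∂(Measure.pi fun _ : Fin (n + 2) => ρ) =
      ∫ x, ∫ w, f (Fin.cons x w : Fin (n + 2) → ℝ) ∂(Measure.pi fun _ : Fin (n + 1) => ρ) ∂ρ := by
  have h := (measurePreserving_piFinSuccAbove (fun _ : Fin (n + 2) => ρ) 0).symm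
  rw [← h.integral_comp', integral_prod]
  · simp [MeasurableEquiv.piFinSuccAbove_symm_apply, Fin.insertNthEquiv]
  · refine Integrable.of_bound (C := C) ?_ (.of_forall fun _ => hC _)
    exact (hf.comp (MeasurableEquiv.measurable _)).aestronglyMeasurable

/-- Conditioning on the first wait turns the integral into a convolution, while the exponential
weights multiply to a constant. The growth bound on ψ serves only for integrability. -/
theorem integral_pieceProd (m : Fin 2) {r : ℝ} (hr : 0 < r) {ψ : ℝ → ℂ} (hψ : Measurable ψ) {a : ℝ}
    (hψa : ∀ x, 0 ≤ x → ‖ψ x‖ ≤ Real.exp (a * x)) (z : ℂ)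
    (hψz : ∀ x, ψ x = pathTransform m 0 z x) (n : ℕ) {t : ℝ} (ht : 0 ≤ t) :
    ∫ w, pieceProd ψ n t w ∂(Measure.pi fun _ : Fin (n + 1) => expMeasure r) =
      (r ^ n * Real.exp (-(r * t)) : ℝ) * pathTransform m n z t := by
  have := isProbabilityMeasure_expMeasure hr
  induction n generalizing t with
  | zero =>
    have hmap := (measurePreserving_eval (fun _ : Fin 1 => expMeasure r) 0).map_eq
    have hf (w : Fin 1 → ℝ) :
        pieceProd ψ 0 t w = (Set.Ioi t).indicator (fun _ => ψ t) (Function.eval 0 w) := by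
      have hp : pieces 0 t w = fun _ => t := by
        ext i; rw [show i = Fin.last 0 from Fin.ext (by omega), pieces, Fin.snoc_last]; simp
      have hS : w ∈ pieceSet 0 t ↔ w 0 ∈ Set.Ioi t := by
        simp [pieceSet, hp, ht]
      by_cases hw : w 0 ∈ Set.Ioi t
      · rw [pieceProd, Set.indicator_of_mem (hS.2 hw), Function.eval, Set.indicator_of_mem hw, hp]
        simp
      · rw [pieceProd, Set.indicator_of_notMem fun h => hw (hS.1 h), Function.eval,
          Set.indicator_of_notMem hw]
    simp only [hf]
    have hint := integral_map (μ := Measure.pi fun _ : Fin 1 => expMeasure r)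
      (φ := Function.eval 0) (f := (Set.Ioi t).indicator (fun _ : ℝ => ψ t))
      (measurable_pi_apply 0).aemeasurable
      (measurable_const.indicator measurableSet_Ioi).aestronglyMeasurable
    rw [hmap] at hint
    refine hint.symm.trans ?_
    rw [integral_expMeasure hr]
    have hg (x : ℝ) : ((r * Real.exp (-(r * x)) : ℝ) : ℂ) * (Set.Ioi t).indicator (fun _ => ψ t) x =
        (Set.Ioi t).indicator (fun x => ((r * Real.exp (-r * x) : ℝ) : ℂ) * ψ t) x := by
      by_cases hx : x ∈ Set.Ioi t <;> simp [hx]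
    simp only [hg]
    rw [setIntegral_indicator measurableSet_Ioi, Set.Ioi_inter_Ioi, max_eq_right ht,
      integral_mul_const, integral_complex_ofReal, integral_const_mul,
      integral_exp_mul_Ioi (by linarith), ← hψz]
    congr 2
    field_simp
  | succ n ih =>
    rw [integral_pi_succ _ (measurable_pieceProd hψ (n + 1) t) (norm_pieceProd_le hψa (n + 1) t),
      integral_expMeasure hr, ← intervalIntegral_pathTransform_mul m n z ht,
      intervalIntegral.integral_of_le ht, ← integral_const_mul,
      ← integral_indicator measurableSet_Ioi, ← integral_indicator measurableSet_Ioc]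
    congr 1; ext x
    by_cases hx : 0 < x
    swap
    · rw [Set.indicator_of_notMem (by simpa using hx), Set.indicator_of_notMem
        fun h => hx h.1]
    rw [Set.indicator_of_mem (Set.mem_Ioi.2 hx)]
    simp only [pieceProd_cons, Set.indicator_of_mem (Set.mem_Ici.2 hx.le)]
    rw [integral_const_mul]
    by_cases hxt : x ≤ t
    · rw [Set.indicator_of_mem (show x ∈ Set.Ioc 0 t from ⟨hx, hxt⟩), ih (sub_nonneg.2 hxt), hψz,
        show Real.exp (-(r * t)) = Real.exp (-(r * x)) * Real.exp (-(r * (t - x))) by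
          rw [← Real.exp_add]; congr 1; ring]
      push_cast
      ring
    · rw [Set.indicator_of_notMem (s := Set.Ioc 0 t) fun h => hxt h.2]
      have h0 : pieceProd ψ n (t - x) = 0 := by
        ext w
        exact Set.indicator_of_notMem
          (fun h => hxt (sub_nonneg.1 (nonneg_of_mem_pieceSet h))) _
      simp [h0]

/-! ### Identification with the Bessel series -/

theorem two_mul_cpow {y : ℂ} (hy : y ≠ 0) (v : ℂ) : (2 * y) ^ v = 2 ^ v * y ^ v := by
  have h := Complex.log_ofReal_mul (r := 2) (by norm_num) hy
  rw [Complex.cpow_def_of_ne_zero (by simpa using hy), Complex.cpow_def_of_ne_zero two_ne_zero,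
    Complex.cpow_def_of_ne_zero hy, ← Complex.exp_add, ← add_mul]
  congr 2
  simpa [Complex.ofReal_log] using h

/-- The branch-dependent factors y^v and (y/2)^v differ only by the positive factor 2^v, so they
cancel for negative y too and an integer power remains. -/
theorem mul_cpow_div_two {y : ℂ} (hy : y ≠ 0) (v : ℝ) (k : ℕ) :
    (2 : ℂ) ^ (v : ℂ) / y ^ (v : ℂ) * (y / 2) ^ (2 * (k : ℂ) + (v : ℂ)) = (y / 2) ^ (2 * k) := by
  have hy2 : y / 2 ≠ 0 := div_ne_zero hy two_ne_zero
  have h := two_mul_cpow hy2 v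
  rw [mul_div_cancel₀ y two_ne_zero] at h
  have e : (2 * (k : ℂ)) = ((2 * k : ℕ) : ℂ) := by push_cast; rfl
  have h2 : (2 : ℂ) ^ (v : ℂ) ≠ 0 := by simp [Complex.cpow_eq_zero_iff]
  have h3 : (y / 2) ^ (v : ℂ) ≠ 0 := by simp [Complex.cpow_eq_zero_iff, hy]
  rw [Complex.cpow_add _ _ hy2, e, Complex.cpow_natCast, h]
  field_simp

theorem tsum_pathTransform (m : Fin 2) (n : ℕ) (z : ℂ) {t : ℝ} (ht : t ≠ 0) :
    (n.factorial / t ^ n : ℂ) * pathTransform m n z t =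
      ∑' k : ℕ, Complex.Gamma ((besselOrder m n : ℂ) + 1) * ((z * t / 2) ^ (2 * k) /
        (Complex.Gamma ((k : ℂ) + 1) * Complex.Gamma ((k : ℂ) + (besselOrder m n : ℂ) + 1))) := by
  have hv := besselOrder_nonneg m n
  have htc : (t : ℂ) ≠ 0 := by exact_mod_cast ht
  have hf (k : ℕ) : (k.factorial : ℂ) ≠ 0 := by exact_mod_cast k.factorial_ne_zero
  rw [pathTransform, ← tsum_mul_left]
  congr 1; ext k
  have e1 : Complex.Gamma ((besselOrder m n : ℂ) + 1) = (Real.Gamma (besselOrder m n + 1) : ℝ) := by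
    rw [← Complex.Gamma_ofReal]; push_cast; rfl
  have e2 : Complex.Gamma ((k : ℂ) + (besselOrder m n : ℂ) + 1) =
      (Real.Gamma (k + besselOrder m n + 1) : ℝ) := by
    rw [← Complex.Gamma_ofReal]; push_cast; rfl
  have hc : ((Real.Gamma (k + besselOrder m n + 1) : ℝ) : ℂ) ≠ 0 := by
    exact_mod_cast (Real.Gamma_pos_of_pos (by positivity)).ne'
  rw [e1, e2, Complex.Gamma_nat_eq_factorial, besselCoeff]
  push_cast
  rw [div_pow, mul_pow, pow_add, pow_mul (2 : ℂ), show (2 : ℂ) ^ 2 = 4 by norm_num]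
  field_simp [hf]

theorem pathTransform_eq_besselI (m : Fin 2) (n : ℕ) {z : ℂ} (hz : z ≠ 0) {t : ℝ} (ht : t ≠ 0) :
    (n.factorial / t ^ n : ℂ) * pathTransform m n z t =
      Complex.Gamma ((besselOrder m n : ℂ) + 1) * (2 : ℂ) ^ (besselOrder m n : ℂ) /
        (z * t) ^ (besselOrder m n : ℂ) * besselI (besselOrder m n) (z * t) := by
  have hy : z * t ≠ 0 := mul_ne_zero hz (by exact_mod_cast ht)
  rw [tsum_pathTransform m n z ht, besselI, ← tsum_mul_left]
  congr 1; ext k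
  rw [← mul_cpow_div_two hy (besselOrder m n) k]
  ring

/-- Only even powers of the argument occur in the transform, so the factor I becomes the sign (-1)^k
and no power I^v arises. -/
theorem pathTransform_eq_besselJ (m : Fin 2) (n : ℕ) {z : ℂ} (hz : z ≠ 0) {t : ℝ} (ht : t ≠ 0) :
    (n.factorial / t ^ n : ℂ) * pathTransform m n (Complex.I * z) t =
      Complex.Gamma ((besselOrder m n : ℂ) + 1) * (2 : ℂ) ^ (besselOrder m n : ℂ) /
        (z * t) ^ (besselOrder m n : ℂ) * besselJ (besselOrder m n) (z * t) := by
  have hy : z * t ≠ 0 := mul_ne_zero hz (by exact_mod_cast ht)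
  rw [tsum_pathTransform m n _ ht, besselJ, ← tsum_mul_left]
  congr 1; ext k
  have e : (Complex.I * z * t / 2) ^ (2 * k) = (-1) ^ k * (z * t / 2) ^ (2 * k) := by
    rw [show Complex.I * z * t / 2 = Complex.I * (z * t / 2) by ring, mul_pow, pow_mul Complex.I,
      Complex.I_sq]
  rw [e, ← mul_cpow_div_two hy (besselOrder m n) k]
  ring

theorem pathTransform_at_zero (m : Fin 2) (n : ℕ) (t : ℝ) :
    pathTransform m n 0 t = t ^ n / n.factorial := by
  refine (hasSum_pathTransform m n 0 t).unique ?_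
  convert hasSum_single 0 ?_ using 1
  · simp [besselCoeff_zero_right]
  · intro k hk
    simp [hk]

/-! ### Joint integration over waiting times and angles -/

theorem norm_exp_mul_cos_le (z : ℂ) {x : ℝ} (hx : 0 ≤ x) (y : ℝ) :
    ‖Complex.exp (z * x * Real.cos y)‖ ≤ Real.exp (‖z‖ * x) := by
  rw [Complex.norm_exp]
  refine Real.exp_le_exp.2 ((Complex.re_le_norm _).trans ?_)
  rw [norm_mul, norm_mul, Complex.norm_real, Complex.norm_real, Real.norm_of_nonneg hx]
  exact mul_le_of_le_one_right (by positivity) (Real.abs_cos_le_one y)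

theorem norm_stepTransform_le (m : Fin 2) [IsProbabilityMeasure (angleLaw ((m : ℕ) : ℝ))] (z : ℂ)
    {x : ℝ} (hx : 0 ≤ x) : ‖stepTransform m (z * x)‖ ≤ Real.exp (‖z‖ * x) := by
  simpa [stepTransform] using norm_integral_le_of_norm_le_const (μ := angleLaw ((m : ℕ) : ℝ))
    (.of_forall (norm_exp_mul_cos_le z hx))

theorem measurable_stepTransform (m : Fin 2) [IsProbabilityMeasure (angleLaw ((m : ℕ) : ℝ))]
    (z : ℂ) : Measurable fun x : ℝ => stepTransform m (z * x) := by
  have h : StronglyMeasurable fun p : ℝ × ℝ => Complex.exp (z * p.1 * Real.cos p.2) :=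
    Continuous.stronglyMeasurable (by fun_prop)
  exact h.integral_prod_right'.measurable

theorem ae_nonneg_expMeasure (r : ℝ) : ∀ᵐ x ∂(expMeasure r), 0 ≤ x := by
  have h : expMeasure r = volume.withDensity fun x => ENNReal.ofReal (exponentialPDFReal r x) := rfl
  rw [h, ae_withDensity_iff (measurable_exponentialPDFReal r).ennreal_ofReal]
  refine .of_forall fun x hx => ?_
  by_contra hlt
  exact hx (exponentialPDF_of_neg (not_le.1 hlt))

/-- The exponential of the displacement as a function of the waiting times and of the angles,
set to zero unless there are exactly `n` events up to time `t`. -/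
noncomputable def pieceExp (z : ℂ) (n : ℕ) (t : ℝ) (p : (Fin (n + 1) → ℝ) × (Fin (n + 1) → ℝ)) :
    ℂ :=
  (pieceSet n t).indicator
    (fun w => ∏ i, Complex.exp (z * pieces n t w i * Real.cos (p.2 i))) p.1

theorem measurable_pieceExp (z : ℂ) (n : ℕ) (t : ℝ) : Measurable (pieceExp z n t) := by
  have h : pieceExp z n t = (Prod.fst ⁻¹' pieceSet n t).indicator
      fun p : (Fin (n + 1) → ℝ) × (Fin (n + 1) → ℝ) => ∏ i, Complex.exp (z * pieces n t p.1 i * Real.cos (p.2 i)) := rfl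
  rw [h]
  refine Measurable.indicator (Finset.measurable_fun_prod _ fun i _ => ?_)
    (measurable_fst (measurableSet_pieceSet n t))
  have : Measurable fun p : (Fin (n + 1) → ℝ) × (Fin (n + 1) → ℝ) => pieces n t p.1 i :=
    (measurable_pieces n t i).comp measurable_fst
  fun_prop

theorem norm_pieceExp_le (z : ℂ) (n : ℕ) (t : ℝ) (p : (Fin (n + 1) → ℝ) × (Fin (n + 1) → ℝ)) :
    ‖pieceExp z n t p‖ ≤ Real.exp (‖z‖ * t) := by
  refine (norm_indicator_eq_indicator_norm _ _).trans_le (Set.indicator_apply_le' (fun hw => ?_)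
    fun _ => (Real.exp_pos _).le)
  calc _ = ∏ i, ‖Complex.exp (z * pieces n t p.1 i * Real.cos (p.2 i))‖ := norm_prod _ _
    _ ≤ ∏ i, Real.exp (‖z‖ * pieces n t p.1 i) :=
        Finset.prod_le_prod (fun _ _ => norm_nonneg _) fun i _ => norm_exp_mul_cos_le z (hw.1 i) _
    _ = Real.exp (‖z‖ * t) := by rw [← Real.exp_sum, ← Finset.mul_sum, sum_pieces]

theorem integral_pieceExp (m : Fin 2) [IsProbabilityMeasure (angleLaw ((m : ℕ) : ℝ))] {r : ℝ}
    (hr : 0 < r) (z : ℂ) (n : ℕ) {t : ℝ} (ht : 0 ≤ t) :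
    ∫ p, pieceExp z n t p ∂((Measure.pi fun _ : Fin (n + 1) => expMeasure r).prod
        (Measure.pi fun _ : Fin (n + 1) => angleLaw ((m : ℕ) : ℝ))) =
      (r ^ n * Real.exp (-(r * t)) : ℝ) * pathTransform m n z t := by
  have := isProbabilityMeasure_expMeasure hr
  rw [← integral_pieceProd m hr (measurable_stepTransform m z)
    (fun x hx => norm_stepTransform_le m z hx) z (fun x => (pathTransform_zero m z x).symm) n ht,
    integral_prod _ (Integrable.of_bound (measurable_pieceExp z n t).aestronglyMeasurable _
      (.of_forall (norm_pieceExp_le z n t)))]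
  congr 1; ext w
  by_cases hw : w ∈ pieceSet n t
  · simp only [pieceExp, pieceProd, Set.indicator_of_mem hw]
    exact integral_fintype_prod_eq_prod
      (fun i y => Complex.exp (z * pieces n t w i * Real.cos y))
  · simp [pieceExp, pieceProd, Set.indicator_of_notMem hw]

/-! ### From the random path to waiting times and angles -/

section PoissonPaths

variable {Ω : Type*} [MeasurableSpace Ω] {μ : Measure Ω} {rate : ℝ}
  {N : ℝ → Ω → ℕ} {s : ℕ → Ω → ℝ} {θ : ℕ → Ω → ℝ}

/-- Since N(t) = n means s_n ≤ t < s_{n+1}, both the event and the position on it depend only on the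
first n + 1 waits and angles. -/
theorem IsPoissonProcess.ae_indicator_exp_eq (hN : IsPoissonProcess N s rate μ) (θ : ℕ → Ω → ℝ)
    (c : ℝ) (z : ℂ) {t : ℝ} (ht : 0 ≤ t) (n : ℕ) :
    ∀ᵐ ω ∂μ, {ω | N t ω = n}.indicator (fun ω => Complex.exp (z * position c N s θ t ω)) ω =
      pieceExp (z * c) n t
        (fun i : Fin (n + 1) => s (i + 1) ω - s i ω, fun i : Fin (n + 1) => θ i ω) := by
  have hpos : ∀ᵐ ω ∂μ, ∀ j : ℕ, 0 ≤ s (j + 1) ω - s j ω :=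
    ae_all_iff.2 fun j => ((hN.hasLaw_wait j).ae_iff (p := fun x => 0 ≤ x)
      (measurableSet_setOfPred.1 measurableSet_Ici)).2 (ae_nonneg_expMeasure rate)
  filter_upwards [hpos, hN.le_count_iff] with ω hω hcount
  set w : Fin (n + 1) → ℝ := fun i => s (i + 1) ω - s i ω with hw
  have hsum : ∑ i : Fin n, w i.castSucc = s n ω := by
    have := Finset.sum_range_sub (fun j => s j ω) n
    rw [hN.time_zero, sub_zero, Finset.sum_range] at this
    simpa [hw] using this
  have hlast : pieces n t w (Fin.last n) = t - s n ω := by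
    rw [pieces, Fin.snoc_last, hsum]
  have hinit (i : Fin n) : pieces n t w i.castSucc = s (i + 1) ω - s i ω := by
    rw [pieces, Fin.snoc_castSucc]; simp [hw]
  have hiff : w ∈ pieceSet n t ↔ N t ω = n := by
    have h1 := hcount t ht n
    have h2 := hcount t ht (n + 1)
    have h3 : N t ω = n ↔ n ≤ N t ω ∧ ¬ n + 1 ≤ N t ω := by omega
    rw [h3, h1, h2, not_le, pieceSet, Set.mem_ofPred_eq, Fin.forall_fin_succ', hlast]
    rw [show w (Fin.last n) = s (n + 1) ω - s n ω from rfl, sub_lt_sub_iff_right, sub_nonneg]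
    simp only [hinit, hω, implies_true, true_and]
  by_cases hn : N t ω = n
  · rw [Set.indicator_of_mem (show ω ∈ {ω | N t ω = n} from hn), pieceExp,
      Set.indicator_of_mem (hiff.2 hn), ← Complex.exp_sum]
    congr 1
    rw [position, hn, Finset.sum_range, Fin.sum_univ_castSucc, Fin.sum_univ_castSucc, hlast]
    have hsw (i : Fin n) : switchTime N s t ((i : ℕ) + 1) ω - switchTime N s t i ω =
        s (i + 1) ω - s i ω := by
      have := i.2
      rw [switchTime, switchTime, if_pos (by omega), if_pos (by omega)]
    have hsl : switchTime N s t (n + 1) ω - switchTime N s t n ω = t - s n ω := by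
      rw [switchTime, switchTime, if_neg (by omega), if_pos (by omega)]
    simp only [Fin.val_castSucc, Fin.val_last, hsw, hsl, hinit]
    push_cast
    rw [mul_add, mul_add, Finset.mul_sum, Finset.mul_sum]
    congr 1
    · exact Finset.sum_congr rfl fun i _ => by ring
    · ring
  · rw [Set.indicator_of_notMem (show ω ∉ {ω | N t ω = n} from hn), pieceExp,
      Set.indicator_of_notMem fun h => hn (hiff.1 h)]

theorem IsPoissonProcess.map_wait_angle [IsProbabilityMeasure μ]
    (hN : IsPoissonProcess N s rate μ)
    (hθ_meas : ∀ j, Measurable (θ j)) (hθ_indep : iIndepFun θ μ)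
    {ρ : Measure ℝ} (hθ_law : ∀ j, HasLaw (θ j) ρ μ)
    (hNθ : IndepFun (fun (ω : Ω) (j : ℕ) => s j ω) (fun (ω : Ω) (j : ℕ) => θ j ω) μ) (n : ℕ) :
    μ.map (fun ω => (fun i : Fin (n + 1) => s (i + 1) ω - s i ω, fun i : Fin (n + 1) => θ i ω)) =
      (Measure.pi fun _ : Fin (n + 1) => expMeasure rate).prod
        (Measure.pi fun _ : Fin (n + 1) => ρ) := by
  have hs := hN.measurable_time
  have hW : μ.map (fun ω (i : Fin (n + 1)) => s (i + 1) ω - s i ω) =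
      Measure.pi fun _ : Fin (n + 1) => expMeasure rate := by
    rw [(iIndepFun_iff_map_fun_eq_pi_map (f := fun (i : Fin (n + 1)) ω => s (i + 1) ω - s i ω)
      (fun i => ((hs _).sub (hs _)).aemeasurable)).1
      (hN.iIndepFun_wait.precomp Fin.val_injective)]
    congr 1; ext1 i
    exact (hN.hasLaw_wait i).map_eq
  have hΘ : μ.map (fun ω (i : Fin (n + 1)) => θ i ω) = Measure.pi fun _ : Fin (n + 1) => ρ := by
    rw [(iIndepFun_iff_map_fun_eq_pi_map (f := fun (i : Fin (n + 1)) ω => θ i ω)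
      (fun i => (hθ_meas _).aemeasurable)).1 (hθ_indep.precomp Fin.val_injective)]
    congr 1; ext1 i
    exact (hθ_law i).map_eq
  have hind : IndepFun (fun ω (i : Fin (n + 1)) => s (i + 1) ω - s i ω)
      (fun ω (i : Fin (n + 1)) => θ i ω) μ :=
    hNθ.comp (φ := fun (x : ℕ → ℝ) (i : Fin (n + 1)) => x (i + 1) - x i)
      (ψ := fun (x : ℕ → ℝ) (i : Fin (n + 1)) => x i) (by fun_prop) (by fun_prop)
  rw [(indepFun_iff_map_prod_eq_prod_map_map (by fun_prop) (by fun_prop)).1 hind, hW, hΘ]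

theorem IsPoissonProcess.integral_exp_position_cond [IsProbabilityMeasure μ]
    (hN : IsPoissonProcess N s rate μ)
    (hrate : 0 < rate) (hθ_meas : ∀ j, Measurable (θ j)) (hθ_indep : iIndepFun θ μ) (m : Fin 2)
    (hθ_law : ∀ j, HasLaw (θ j) (angleLaw ((m : ℕ) : ℝ)) μ)
    (hNθ : IndepFun (fun (ω : Ω) (j : ℕ) => s j ω) (fun (ω : Ω) (j : ℕ) => θ j ω) μ) (c : ℝ)
    {t : ℝ} (ht : 0 < t) (n : ℕ) (z : ℂ) :
    Integrable (fun ω => Complex.exp (z * position c N s θ t ω)) (cond μ {ω | N t ω = n}) ∧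
      ∫ ω, Complex.exp (z * position c N s θ t ω) ∂(cond μ {ω | N t ω = n}) =
        (n.factorial / t ^ n : ℂ) * pathTransform m n (z * c) t := by
  have hρ : IsProbabilityMeasure (angleLaw ((m : ℕ) : ℝ)) :=
    (hθ_law 0).isProbabilityMeasure_iff.1 inferInstance
  have hs := hN.measurable_time
  have hmeas : Measurable fun ω => (fun i : Fin (n + 1) => s (i + 1) ω - s i ω,
      fun i : Fin (n + 1) => θ i ω) := by fun_prop
  have hS : MeasurableSet {ω | N t ω = n} := hN.measurable_count t (measurableSet_singleton n)
  have hmap := hN.map_wait_angle hθ_meas hθ_indep hθ_law hNθ n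
  have hint (z : ℂ) : IntegrableOn (fun ω => Complex.exp (z * position c N s θ t ω))
      {ω | N t ω = n} μ := by
    rw [← integrable_indicator_iff hS]
    refine Integrable.congr ?_ (Filter.EventuallyEq.symm (hN.ae_indicator_exp_eq θ c z ht.le n))
    exact Integrable.of_bound ((measurable_pieceExp _ n t).comp hmeas).aestronglyMeasurable _
      (.of_forall fun ω => norm_pieceExp_le _ n t _)
  have hval (z : ℂ) : ∫ ω in {ω | N t ω = n}, Complex.exp (z * position c N s θ t ω) ∂μ =
      (rate ^ n * Real.exp (-(rate * t)) : ℝ) * pathTransform m n (z * c) t := by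
    rw [← integral_indicator hS, integral_congr_ae (hN.ae_indicator_exp_eq θ c z ht.le n),
      ← integral_pieceExp m hrate (z * c) n ht.le, ← hmap,
      integral_map hmeas.aemeasurable (measurable_pieceExp _ n t).aestronglyMeasurable]
  -- The Poisson distribution of N(t) is not part of `IsPoissonProcess`; it comes out as the case z
  -- = 0.
  have hprob : ((μ.real {ω | N t ω = n} : ℝ) : ℂ) =
      (rate ^ n * Real.exp (-(rate * t)) : ℝ) * (t ^ n / n.factorial) := by
    have := hval 0
    rw [zero_mul, pathTransform_at_zero] at this
    simpa using this
  have hA : ((rate ^ n * Real.exp (-(rate * t)) : ℝ) : ℂ) ≠ 0 := by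
    exact_mod_cast (by positivity : rate ^ n * Real.exp (-(rate * t)) ≠ 0)
  have htc : (t : ℂ) ≠ 0 := by exact_mod_cast ht.ne'
  have hf : (n.factorial : ℂ) ≠ 0 := by exact_mod_cast n.factorial_ne_zero
  have h0 : μ {ω | N t ω = n} ≠ 0 := by
    intro h
    rw [measureReal_def, h, ENNReal.toReal_zero, Complex.ofReal_zero] at hprob
    exact mul_ne_zero hA (div_ne_zero (pow_ne_zero _ htc) hf) hprob.symm
  refine ⟨(hint z).smul_measure (ENNReal.inv_ne_top.2 h0), ?_⟩
  rw [ProbabilityTheory.cond, integral_smul_measure, hval, ENNReal.toReal_inv, ← measureReal_def,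
    Complex.real_smul, Complex.ofReal_inv, hprob]
  field_simp

end PoissonPaths

/-! ### The conditional transforms -/

theorem corollary1 {Ω : Type*} [MeasurableSpace Ω] (μ : Measure Ω) [IsProbabilityMeasure μ]
    (c rate : ℝ) (hc : 0 < c) (hrate : 0 < rate)
    (m : Fin 2)
    (N : ℝ → Ω → ℕ) (s : ℕ → Ω → ℝ) (hN : IsPoissonProcess N s rate μ)
    (θ : ℕ → Ω → ℝ) (hθ_meas : ∀ j, Measurable (θ j))
    (hθ_indep : iIndepFun θ μ)
    (hθ_law : ∀ j, HasLaw (θ j) (angleLaw ((m : ℕ) : ℝ)) μ)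
    (hNθ : IndepFun (fun (ω : Ω) (j : ℕ) => s j ω) (fun (ω : Ω) (j : ℕ) => θ j ω) μ)
    (t : ℝ) (ht : 0 < t) (n : ℕ) (hn : 1 ≤ n) :
    (∀ α : ℝ, α ≠ 0 →
      Integrable (fun ω => Complex.exp (Complex.I * α * position c N s θ t ω))
        (cond μ {ω | N t ω = n}) ∧
      ∫ ω, Complex.exp (Complex.I * α * position c N s θ t ω) ∂(cond μ {ω | N t ω = n}) =
        Complex.Gamma ((besselOrder m n : ℂ) + 1) * (2 : ℂ) ^ (besselOrder m n : ℂ) /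
          ((α : ℂ) * c * t) ^ (besselOrder m n : ℂ) *
          besselJ (besselOrder m n) ((α : ℂ) * c * t)) ∧
    (∀ β : ℝ, β ≠ 0 →
      Integrable (fun ω => Real.exp (β * position c N s θ t ω)) (cond μ {ω | N t ω = n}) ∧
      ((∫ ω, Real.exp (β * position c N s θ t ω) ∂(cond μ {ω | N t ω = n}) : ℝ) : ℂ) =
        Complex.Gamma ((besselOrder m n : ℂ) + 1) * (2 : ℂ) ^ (besselOrder m n : ℂ) /
          ((β : ℂ) * c * t) ^ (besselOrder m n : ℂ) *
          besselI (besselOrder m n) ((β : ℂ) * c * t)) := by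
  have key := hN.integral_exp_position_cond hrate hθ_meas hθ_indep m hθ_law hNθ c ht n
  have hcast {a : ℝ} (ha : a ≠ 0) : (a : ℂ) * c ≠ 0 := by
    exact_mod_cast mul_ne_zero ha hc.ne'
  refine ⟨fun α hα => ⟨(key _).1, ?_⟩, fun β hβ => ?_⟩
  · rw [(key _).2, mul_assoc, pathTransform_eq_besselJ m n (hcast hα) ht.ne']
  · obtain ⟨h1, h2⟩ := key β
    -- For real β the complex integrand is the cast of a real one, so the real statements follow
    -- from the complex ones.
    simp only [← Complex.ofReal_mul, ← Complex.ofReal_exp] at h1 h2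
    refine ⟨by simpa only [RCLike.re_to_complex, Complex.ofReal_re] using h1.re, ?_⟩
    rw [← integral_complex_ofReal, h2, Complex.ofReal_mul,
      pathTransform_eq_besselI m n (hcast hβ) ht.ne']
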